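/- **Theorem (SI-Wasserstein expert).** Let $d\ge 0$, $p=d+1$, and write $\xi=(X,Y)\in\mathbb R^d\times\mathbb R=\mathbb R^p$. Let $(\widehat\mu_{\rm S},\widehat\Sigma_{\rm S}),(\widehat\mu_{\rm T},\widehat\Sigma_{\rm T})\in\mathbb R^p\times\mathbb S^p_+$, $\rho_{\rm S},\rho_{\rm T}\in\mathbb R$ and $\varepsilon>0$. Here $\mathbb S^p_+$ is the set of symmetric positive semidefinite matrices, and for $(\mu,\Sigma),(\widehat\mu,\widehat\Sigma)\in\mathbb R^p\times\mathbb S^p_+$ let $$\mathds W\big((\mu,\Sigma)\,\|\,(\widehat\mu,\widehat\Sigma)\big)=\|\mu-\widehat\mu\|_2^2+\mathrm{Tr}\Big(\Sigma+\widehat\Sigma-2\big(\widehat\Sigma^{1/2}\Sigma\widehat\Sigma^{1/2}\big)^{1/2}\Big).$$ Let $\mathbb U$ be the set of all $(\mu,\Sigma)\in\mathbb R^p\times\mathbb S^p_+$ with $\mathds W((\mu,\Sigma)\|(\widehat\mu_k,\widehat\Sigma_k))\le\rho_k$ for $k\in\{{\rm S},{\rm T}\}$ and $\Sigma+\mu\mu^\top\succeq\varepsilon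 I_p$, and let $\mathbb B$ be the set of all probability distributions on $\mathbb R^p$ with finite second moments whose mean vector and covariance matrix form a pair in $\mathbb U$. Assume that $\mathbb B\neq\emptyset$. Consider the linear semidefinite program $$\begin{array}{cl}\sup&\tau\\ \text{s.t.}& M_{XX}\in\mathbb R^{d\times d},\ M_{XY}\in\mathbb R^{d\times1},\ M_{YY}\in\mathbb R,\ \tau\in\mathbb R_+,\ \mu\in\mathbb R^p,\ M,H\in\mathbb S^p_+,\ C_{\rm S},C_{\rm T}\in\mathbb R^{p\times p},\\[1ex] &\left.\begin{array}{l}\|\widehat\mu_k\|_2^2-2\widehat\mu_k^\top\mu+\mathrm{Tr}(M+\widehat\Sigma_k-2C_k)\le\rho_k\\[0.5ex] \begin{bmatrix}H&C_k\\C_k^\top&\widehat\Sigma_k\end{bmatrix}\succeq0\end{array}\right\}\ k\in\{{\rm S},{\rm T}\},\\[3ex] &\begin{bmatrix}M-H&\mu\\\mu^\top&1\end{bmatrix}\succeq0,\quad \begin{bmatrix}M_{XX}&M_{XY}\\M_{XY}^\top&M_{YY}-\tau\end{bmatrix}\succeq0,\quad M=\begin{bmatrix}M_{XX}&M_{XY}\\M_{XY}^\top&M_{YY}\end{bmatrix}\succeq\varepsilon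 I_p.\end{array}$$ Then this program has an optimal solution. Moreover, for every optimal solution, with components $M^\star_{XX},M^\star_{XY}$, the matrix $M^\star_{XX}$ is invertible and $\beta^\star=(M^\star_{XX})^{-1}M^\star_{XY}$ solves the robust least-squares problem $$\inf_{\beta\in\mathbb R^d}\ \sup_{\mathbb Q\in\mathbb B}\ \mathbb E_{\mathbb Q}\big[(\beta^\top X-Y)^2\big],$$ that is, $\beta^\star$ attains the infimum. -/

import Mathlib

open Matrix MeasureTheory ProbabilityTheory
open scoped MatrixOrder

namespace RobustLS

/-- The two domains: source `S` and target `T`. -/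
inductive Domain
  | S
  | T

/-- Coordinates of the joint vector `ξ = (X, Y)`, with `X` of dimension `d` and `Y` scalar;
there are `p = d + 1` of them. -/
abbrev Joint (d : ℕ) := Fin d ⊕ Unit

/-- The symmetric bordered matrix `[A, b; bᵀ, c]`. -/
def bordered {n : Type*} (A : Matrix n n ℝ) (b : n → ℝ) (c : ℝ) :
    Matrix (n ⊕ Unit) (n ⊕ Unit) ℝ :=
  fromBlocks A (replicateCol Unit b) (replicateRow Unit b) (of fun _ _ => c)

/-- The Wasserstein-type (Gelbrich) divergence `W((μ, Σ) ‖ (m, S))`, that is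
`‖μ - m‖₂² + Tr(Σ + S - 2 (S^{1/2} Σ S^{1/2})^{1/2})`. -/
noncomputable def wassersteinDiv {n : Type*} [Fintype n] [DecidableEq n]
    (μ : n → ℝ) (Sig : Matrix n n ℝ) (m : n → ℝ) (S : Matrix n n ℝ) : ℝ :=
  ‖WithLp.toLp 2 (μ - m)‖ ^ 2
    + (Sig + S - (2 : ℝ) • CFC.sqrt (CFC.sqrt S * Sig * CFC.sqrt S)).trace

/-- The moment set: pairs `(μ, Σ)`, `Σ ⪰ 0`, in both Wasserstein balls (centre
`(μhat k, Sighat k)`, radius `ρ k`) and with `Σ + μ μᵀ ⪰ ε I`. -/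
def momentSet {n : Type*} [Fintype n] [DecidableEq n]
    (μhat : Domain → n → ℝ) (Sighat : Domain → Matrix n n ℝ) (ρ : Domain → ℝ) (ε : ℝ) :
    Set ((n → ℝ) × Matrix n n ℝ) :=
  {u | u.2.PosSemidef ∧
    (∀ k, wassersteinDiv u.1 u.2 (μhat k) (Sighat k) ≤ ρ k) ∧
    (u.2 + vecMulVec u.1 u.1 - ε • (1 : Matrix n n ℝ)).PosSemidef}

/-- `Q ∼ (μ, Σ)`: `Q` is a probability distribution with finite second moments, mean vector `μ`
and covariance matrix `Σ`. -/
structure HasMoments {n : Type*} (Q : Measure (n → ℝ)) (μ : n → ℝ) (Sig : Matrix n n ℝ) :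
    Prop where
  prob : IsProbabilityMeasure Q
  memLp : ∀ i, MemLp (fun ξ : n → ℝ => ξ i) 2 Q
  mean : ∀ i, ∫ ξ, ξ i ∂Q = μ i
  cov : ∀ i j, covariance (fun ξ : n → ℝ => ξ i) (fun ξ : n → ℝ => ξ j) Q = Sig i j

/-- The set of all distributions whose mean and covariance lie in the moment set. -/
def distributionSet {n : Type*} [Fintype n] [DecidableEq n]
    (μhat : Domain → n → ℝ) (Sighat : Domain → Matrix n n ℝ) (ρ : Domain → ℝ) (ε : ℝ) :
    Set (Measure (n → ℝ)) :=
  {Q | ∃ u ∈ momentSet μhat Sighat ρ ε, HasMoments Q u.1 u.2}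

/-- The worst-case risk `sup_{Q ∈ B} E_Q[(βᵀ X - Y)²]`, in `[0, ∞]`. -/
noncomputable def worstCaseRisk {d : ℕ} (B : Set (Measure (Joint d → ℝ))) (β : Fin d → ℝ) :
    ENNReal :=
  ⨆ Q ∈ B, ∫⁻ ξ, ENNReal.ofReal ((β ⬝ᵥ (fun i => ξ (Sum.inl i)) - ξ (Sum.inr ())) ^ 2) ∂Q

/-- `β` solves `inf_β sup_{Q ∈ B} E_Q[(βᵀ X - Y)²]`. -/
def SolvesRobustLS {d : ℕ} (B : Set (Measure (Joint d → ℝ))) (β : Fin d → ℝ) : Prop :=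
  ∀ β' : Fin d → ℝ, worstCaseRisk B β ≤ worstCaseRisk B β'

/-- The decision variables of the semidefinite program. -/
structure SDPVar (d : ℕ) where
  MXX : Matrix (Fin d) (Fin d) ℝ
  MXY : Fin d → ℝ
  MYY : ℝ
  τ : ℝ
  μ : Joint d → ℝ
  M : Matrix (Joint d) (Joint d) ℝ
  H : Matrix (Joint d) (Joint d) ℝ
  C : Domain → Matrix (Joint d) (Joint d) ℝ

/-- The constraints of the semidefinite program. -/
structure SDPFeasible {d : ℕ} (μhat : Domain → Joint d → ℝ)
    (Sighat : Domain → Matrix (Joint d) (Joint d) ℝ) (ρ : Domain → ℝ) (ε : ℝ)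
    (v : SDPVar d) : Prop where
  τ_nonneg : 0 ≤ v.τ
  M_psd : v.M.PosSemidef
  H_psd : v.H.PosSemidef
  ball : ∀ k, ‖WithLp.toLp 2 (μhat k)‖ ^ 2 - 2 * (μhat k ⬝ᵥ v.μ)
    + (v.M + Sighat k - (2 : ℝ) • v.C k).trace ≤ ρ k
  C_block : ∀ k, (fromBlocks v.H (v.C k) (v.C k)ᵀ (Sighat k)).PosSemidef
  H_block : (bordered (v.M - v.H) v.μ 1).PosSemidef
  τ_block : (bordered v.MXX v.MXY (v.MYY - v.τ)).PosSemidef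
  M_eq : v.M = bordered v.MXX v.MXY v.MYY
  M_ge : (v.M - ε • (1 : Matrix (Joint d) (Joint d) ℝ)).PosSemidef

/-- `v` is an optimal solution of: maximize `τ` subject to the constraints. -/
def SDPOptimal {d : ℕ} (μhat : Domain → Joint d → ℝ)
    (Sighat : Domain → Matrix (Joint d) (Joint d) ℝ) (ρ : Domain → ℝ) (ε : ℝ)
    (v : SDPVar d) : Prop :=
  SDPFeasible μhat Sighat ρ ε v ∧ ∀ w, SDPFeasible μhat Sighat ρ ε w → w.τ ≤ v.τ

end RobustLS

/-!
The objective `E_Q[(βᵀ X - Y)²]` depends on `Q` only through its second moment matrix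
`M = Σ + μ μᵀ`: it is the quadratic form of `M` at `(β, -1)`, hence affine in `M` and, for
`M_XX ⪰ ε I`, strongly convex in `β` (`secondMomentRisk`). Gaussian distributions realise all
moments (`exists_hasMoments`), so the problem is `inf_β sup_M`, with `M` ranging over the second
moment matrices of the moment set.

These matrices are exactly the `M`-components of the feasible points of the semidefinite program
(`SDPFeasible.mem_momentSet`, `exists_feasible_of_mem_momentSet`). The non-linear term of the
Wasserstein divergence is linearised by
`Tr (S^{1/2} H S^{1/2})^{1/2} = max {Tr C : [H, C; Cᵀ, S] ⪰ 0}`. The bound `≥` comes from pairing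
the block matrix with a regularised optimal dual matrix `[A, -I; -I, A⁻¹]`
(`trace_le_trace_sqrt`); a maximiser is written down with the pseudo-inverse of
`(S^{1/2} H S^{1/2})^{1/2}` (`exists_trace_eq_trace_sqrt`). Neither `S` nor `H` has
to be invertible.

The largest `τ` admitted by `M` is the Schur complement of `M_XX`, that is `min_β` of the risk, so
the program is `sup_M min_β`. Its feasible set is compact (`isCompact_feasible`), so the supremum
is attained. Let `M⋆` be optimal, with minimiser `β⋆ = (M⋆_XX)⁻¹ M⋆_XY` and value `τ⋆`. For another
feasible `M` and `t ∈ (0, 1]` put `M_t = (1 - t) M⋆ + t M`. The vector `β⋆` solves the normal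
equations of `M_t` up to a residual `t g`, so its risk at `M_t` exceeds the least one by at most
`t² ‖g‖² / ε`; the least one is at most `τ⋆`. Dividing by `t` and letting `t → 0` shows that the
risk of `β⋆` at `M` is at most `τ⋆` (`SDPOptimal.risk_le`). Every other `β` has risk at least `τ⋆`
at `M⋆`, so `(β⋆, M⋆)` is a saddle point.
-/

namespace RobustLS

/-! ### Positive semidefinite real matrices -/

section PosSemidef

variable {m n : Type*} [Fintype m] [Fintype n]

theorem posSemidef_iff_real {A : Matrix n n ℝ} :
    A.PosSemidef ↔ Aᵀ = A ∧ ∀ x, 0 ≤ x ⬝ᵥ A *ᵥ x := by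
  rw [posSemidef_iff_dotProduct_mulVec, IsHermitian, conjTranspose_eq_transpose_of_trivial]
  simp

theorem _root_.Matrix.PosSemidef.transpose_eq_self {A : Matrix n n ℝ} (hA : A.PosSemidef) :
    Aᵀ = A :=
  (posSemidef_iff_real.1 hA).1

theorem _root_.Matrix.PosSemidef.quadForm_nonneg {A : Matrix n n ℝ} (hA : A.PosSemidef)
    (x : n → ℝ) : 0 ≤ x ⬝ᵥ A *ᵥ x :=
  (posSemidef_iff_real.1 hA).2 x

omit [Fintype n] in
theorem _root_.Matrix.PosSemidef.convexComb {A B : Matrix n n ℝ} (hA : A.PosSemidef)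
    (hB : B.PosSemidef) {s t : ℝ} (hs : 0 ≤ s) (ht : 0 ≤ t) : (s • A + t • B).PosSemidef :=
  (hA.smul hs).add (hB.smul ht)

theorem isClosed_posSemidef : IsClosed {A : Matrix n n ℝ | A.PosSemidef} := by
  simp only [posSemidef_iff_real, Set.ofPred_and, Set.ofPred_forall]
  refine (isClosed_eq (by fun_prop) continuous_id).inter (isClosed_iInter fun x => ?_)
  exact isClosed_le continuous_const (by fun_prop)

theorem mulVec_dotProduct_of_symm {A : Matrix n n ℝ} (hA : Aᵀ = A) (x y : n → ℝ) :
    (A *ᵥ x) ⬝ᵥ y = x ⬝ᵥ A *ᵥ y := by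
  rw [dotProduct_mulVec, ← mulVec_transpose, hA]

theorem quadForm_fromBlocks {A : Matrix m m ℝ} {B : Matrix m n ℝ} {D : Matrix n n ℝ}
    (x : m → ℝ) (y : n → ℝ) :
    Sum.elim x y ⬝ᵥ fromBlocks A B Bᵀ D *ᵥ Sum.elim x y
      = x ⬝ᵥ A *ᵥ x + 2 * (x ⬝ᵥ B *ᵥ y) + y ⬝ᵥ D *ᵥ y := by
  have h : y ⬝ᵥ Bᵀ *ᵥ x = x ⬝ᵥ B *ᵥ y := by
    rw [dotProduct_mulVec, vecMul_transpose, dotProduct_comm]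
  rw [fromBlocks_mulVec, sumElim_dotProduct_sumElim]
  simp only [Sum.elim_comp_inl, Sum.elim_comp_inr, dotProduct_add, h]
  ring

theorem quadForm_bordered {A : Matrix n n ℝ} {b : n → ℝ} {c : ℝ} (x : n → ℝ) (s : ℝ) :
    Sum.elim x (fun _ : Unit => s) ⬝ᵥ bordered A b c *ᵥ Sum.elim x (fun _ : Unit => s)
      = x ⬝ᵥ A *ᵥ x + 2 * s * (b ⬝ᵥ x) + s ^ 2 * c := by
  have h : replicateRow Unit b = (replicateCol Unit b)ᵀ := by simp
  rw [bordered, h, quadForm_fromBlocks]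
  have h1 : replicateCol Unit b *ᵥ (fun _ : Unit => s) = s • b := by
    ext i; simp [mulVec, dotProduct, mul_comm]
  rw [h1, dotProduct_smul, dotProduct_comm x b]
  simp [dotProduct, mulVec]
  ring

omit [Fintype n] in
theorem transpose_bordered {A : Matrix n n ℝ} (hA : Aᵀ = A) (b : n → ℝ) (c : ℝ) :
    (bordered A b c)ᵀ = bordered A b c := by
  rw [bordered, fromBlocks_transpose, hA]
  congr 1

theorem posSemidef_bordered {A : Matrix n n ℝ} (hA : Aᵀ = A) {b : n → ℝ} {c : ℝ}
    (h : ∀ x s, 0 ≤ x ⬝ᵥ A *ᵥ x + 2 * s * (b ⬝ᵥ x) + s ^ 2 * c) :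
    (bordered A b c).PosSemidef := by
  refine posSemidef_iff_real.2 ⟨transpose_bordered hA b c, fun z => ?_⟩
  have hz : z = Sum.elim (z ∘ Sum.inl) (fun _ : Unit => z (Sum.inr ())) := by
    ext (i | i) <;> rfl
  rw [hz, quadForm_bordered]
  exact h _ _

theorem quadForm_vecMulVec (v x : n → ℝ) :
    x ⬝ᵥ vecMulVec v v *ᵥ x = (v ⬝ᵥ x) ^ 2 := by
  rw [vecMulVec_mulVec, dotProduct_smul, dotProduct_comm x v]
  simp [sq]

theorem posSemidef_vecMulVec (v : n → ℝ) : (vecMulVec v v).PosSemidef := by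
  simpa using posSemidef_vecMulVec_self_star v

/-- The Schur complement condition for a matrix bordered with corner `1`. -/
theorem posSemidef_bordered_one_iff {A : Matrix n n ℝ} {b : n → ℝ} :
    (bordered A b 1).PosSemidef ↔ (A - vecMulVec b b).PosSemidef := by
  constructor
  · intro h
    have hA : Aᵀ = A := by
      have := PosSemidef.transpose_eq_self h
      rw [bordered, fromBlocks_transpose, fromBlocks_inj] at this
      exact this.1
    refine posSemidef_iff_real.2 ⟨?_, fun x => ?_⟩
    · rw [transpose_sub, hA, PosSemidef.transpose_eq_self (posSemidef_vecMulVec b)]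
    · have := PosSemidef.quadForm_nonneg h (Sum.elim x fun _ => -(b ⬝ᵥ x))
      rw [quadForm_bordered] at this
      rw [sub_mulVec, dotProduct_sub, quadForm_vecMulVec]
      linarith
  · intro h
    have hA : Aᵀ = A := by
      have := PosSemidef.transpose_eq_self (h.add (posSemidef_vecMulVec b))
      simpa using this
    refine posSemidef_bordered hA fun x s => ?_
    have := PosSemidef.quadForm_nonneg h x
    rw [sub_mulVec, dotProduct_sub, quadForm_vecMulVec] at this
    nlinarith [sq_nonneg (s + b ⬝ᵥ x)]

variable [DecidableEq n]

theorem _root_.Matrix.PosSemidef.trace_mul_nonneg {A B : Matrix n n ℝ} (hA : A.PosSemidef)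
    (hB : B.PosSemidef) : 0 ≤ (A * B).trace := by
  have hs : (CFC.sqrt B)ᴴ = CFC.sqrt B := (CFC.sqrt_nonneg B).posSemidef.1
  have := (hA.conjTranspose_mul_mul_same (CFC.sqrt B)).trace_nonneg
  rwa [hs, trace_mul_comm, ← Matrix.mul_assoc, CFC.sqrt_mul_sqrt_self B hB.nonneg,
    trace_mul_comm] at this

omit [Fintype n] in
theorem posDef_of_sub_smul_one {A : Matrix n n ℝ} {ε : ℝ} (hε : 0 < ε)
    (hA : (A - ε • (1 : Matrix n n ℝ)).PosSemidef) : A.PosDef := by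
  have := (PosDef.one (n := n) (R := ℝ)).smul hε |>.posSemidef_add hA
  simpa using this

end PosSemidef

/-! ### The semidefinite characterisation of the Gelbrich term -/

section Gelbrich

variable {n : Type*} [Fintype n] [DecidableEq n]

/-- Pairing the block matrix with the positive semidefinite matrix `[A, -I; -I, A⁻¹]`. -/
theorem two_mul_trace_le_of_posDef {H C S A : Matrix n n ℝ}
    (h : (fromBlocks H C Cᵀ S).PosSemidef) (hA : A.PosDef) :
    2 * C.trace ≤ (H * A).trace + (S * A⁻¹).trace := by
  have hZ : (fromBlocks A (-1) (-1)ᴴ A⁻¹).PosSemidef := by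
    have := hA.isUnit.invertible
    rw [PosDef.fromBlocks₁₁ _ _ hA]
    simpa using PosSemidef.zero
  have := PosSemidef.trace_mul_nonneg h hZ
  simp [fromBlocks_multiply, trace, Fintype.sum_sum_type, Finset.sum_add_distrib] at this ⊢
  linarith

/-- The inequality `Tr C ≤ Tr T`, `T = (S^{1/2} H S^{1/2})^{1/2}`, up to an error of order `δ`.
The regularisation makes the argument work for singular `S` and `H`. -/
theorem two_mul_trace_le_add_error {H C S : Matrix n n ℝ} (hH : H.PosSemidef)
    (hS : S.PosSemidef) (h : (fromBlocks H C Cᵀ S).PosSemidef) {δ : ℝ} (hδ : 0 < δ) :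
    2 * C.trace ≤ 2 * (CFC.sqrt (CFC.sqrt S * H * CFC.sqrt S)).trace
      + δ * (H.trace + Fintype.card n) := by
  set R := CFC.sqrt S
  set T := CFC.sqrt (R * H * R)
  have hRh : Rᴴ = R := (CFC.sqrt_nonneg S).posSemidef.1
  have hRR : R * R = S := CFC.sqrt_mul_sqrt_self S hS.nonneg
  have hRHR : (R * H * R).PosSemidef := by
    have := hH.conjTranspose_mul_mul_same R
    rwa [hRh] at this
  have hTT : T * T = R * H * R := CFC.sqrt_mul_sqrt_self _ hRHR.nonneg
  have hTp : T.PosSemidef := (CFC.sqrt_nonneg _).posSemidef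
  have hone : (δ • (1 : Matrix n n ℝ)).PosDef := PosDef.one.smul hδ
  have hD : (T + δ • (1 : Matrix n n ℝ)).PosDef := hone.posSemidef_add hTp
  set D := T + δ • (1 : Matrix n n ℝ) with hDdef
  have hDu : IsUnit D.det := (isUnit_iff_isUnit_det D).1 hD.isUnit
  have hRDR : (R * D⁻¹ * R).PosSemidef := by
    have := hD.inv.posSemidef.conjTranspose_mul_mul_same R
    rwa [hRh] at this
  -- In the nonsingular case with `δ = 0` this is the matrix for which equality holds.
  set A := R * D⁻¹ * R + δ • (1 : Matrix n n ℝ) with hA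
  have hAp : A.PosDef := hone.posSemidef_add hRDR
  have h1 : (D - R * A⁻¹ * R).PosSemidef := by
    have := hD.isUnit.invertible
    have := hAp.isUnit.invertible
    have hb : (fromBlocks A R Rᴴ D).PosSemidef := by
      rw [PosDef.fromBlocks₂₂ _ _ hD, hRh, hA, add_sub_cancel_left]
      exact hone.posSemidef
    rwa [PosDef.fromBlocks₁₁ _ _ hAp, hRh] at hb
  have h2 : (S * A⁻¹).trace ≤ T.trace + δ * Fintype.card n := by
    have h3 := h1.trace_nonneg
    have h4 : (R * A⁻¹ * R).trace = (S * A⁻¹).trace := by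
      rw [trace_mul_comm, ← Matrix.mul_assoc, hRR]
    rw [trace_sub, h4, hDdef, trace_add, trace_smul, trace_one, smul_eq_mul] at h3
    linarith
  have h5 : (H * A).trace ≤ T.trace + δ * H.trace := by
    have h6 : (H * (R * D⁻¹ * R)).trace = (T * T * D⁻¹).trace := by
      rw [hTT, ← Matrix.mul_assoc, trace_mul_comm]
      simp only [Matrix.mul_assoc]
    have h7 : (T * T * D⁻¹).trace + δ * (T * D⁻¹).trace = T.trace := by
      rw [← smul_eq_mul δ, ← trace_smul, ← trace_add, ← Matrix.smul_mul, ← add_mul]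
      have : T * T + δ • T = T * D := by simp [hDdef, mul_add]
      rw [this, Matrix.mul_assoc, mul_nonsing_inv D hDu, Matrix.mul_one]
    have h8 := mul_nonneg hδ.le (hTp.trace_mul_nonneg hD.inv.posSemidef)
    rw [hA, mul_add, trace_add, h6, Matrix.mul_smul, Matrix.mul_one, trace_smul, smul_eq_mul]
    linarith
  have := two_mul_trace_le_of_posDef h hAp
  linarith

theorem trace_le_trace_sqrt {H C S : Matrix n n ℝ} (hH : H.PosSemidef)
    (hS : S.PosSemidef) (h : (fromBlocks H C Cᵀ S).PosSemidef) :
    C.trace ≤ (CFC.sqrt (CFC.sqrt S * H * CFC.sqrt S)).trace := by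
  have hk : 0 < H.trace + Fintype.card n + 1 := by
    have := hH.trace_nonneg
    positivity
  refine le_of_forall_pos_le_add fun e he => ?_
  have := two_mul_trace_le_add_error hH hS h (div_pos he hk)
  have h2 : e / (H.trace + Fintype.card n + 1) * (H.trace + Fintype.card n) ≤ e := by
    rw [div_mul_eq_mul_div, div_le_iff₀ hk]
    nlinarith
  linarith

/-- The upper bound `trace_le_trace_sqrt` is attained. With `R = S^{1/2}` and
`T = (R H R)^{1/2}`, the maximiser is `H R T⁺ R`, where `T⁺` is the pseudo-inverse of `T`. -/
theorem exists_trace_eq_trace_sqrt {H S : Matrix n n ℝ} (hH : H.PosSemidef)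
    (hS : S.PosSemidef) : ∃ C : Matrix n n ℝ, (fromBlocks H C Cᵀ S).PosSemidef ∧
      C.trace = (CFC.sqrt (CFC.sqrt S * H * CFC.sqrt S)).trace := by
  set R := CFC.sqrt S
  set T := CFC.sqrt (R * H * R)
  have hRh : Rᵀ = R := (CFC.sqrt_nonneg S).posSemidef.transpose_eq_self
  have hRR : R * R = S := CFC.sqrt_mul_sqrt_self S hS.nonneg
  have hRHR : (R * H * R).PosSemidef := by
    have := hH.conjTranspose_mul_mul_same R
    rwa [conjTranspose_eq_transpose_of_trivial, hRh] at this
  have hTT : T * T = R * H * R := CFC.sqrt_mul_sqrt_self _ hRHR.nonneg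
  have hTp : T.PosSemidef := (CFC.sqrt_nonneg _).posSemidef
  have hcont : ∀ f : ℝ → ℝ, ContinuousOn f (spectrum ℝ T) := fun f =>
    (Matrix.finite_real_spectrum (A := T)).continuousOn f
  -- As `0⁻¹ = 0`, applying the inversion of real numbers to `T` gives the pseudo-inverse.
  set P := cfc (fun x : ℝ => x⁻¹) T
  have hPh : Pᵀ = P := by
    have : IsSelfAdjoint P := cfc_predicate _ _
    rwa [IsSelfAdjoint, star_eq_conjTranspose, conjTranspose_eq_transpose_of_trivial] at this
  have hTid : cfc (fun x : ℝ => x) T = T := cfc_id' ℝ T hTp.1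
  have hTTP : T * T * P = T := by
    calc T * T * P = cfc (fun x : ℝ => x * x * x⁻¹) T := by
          rw [cfc_mul _ _ T (hcont _) (hcont _), cfc_mul _ _ T (hcont _) (hcont _), hTid]
      _ = cfc (fun x : ℝ => x) T := by
          congr 1; ext x; exact mul_self_mul_inv x
      _ = T := hTid
  have hPT : P * T = T * P := by
    have := (cfc_commute_cfc (fun x : ℝ => x⁻¹) (fun x : ℝ => x) T).eq
    rwa [hTid] at this
  set E := T * P with hE
  have hEh : Eᵀ = E := by rw [hE, transpose_mul, hPh, hTp.transpose_eq_self, hPT]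
  have hEE : E * E = E := by
    calc E * E = T * (P * T) * P := by simp only [hE, Matrix.mul_assoc]
      _ = T * T * P * P := by rw [hPT]; simp only [hE, Matrix.mul_assoc]
      _ = E := by rw [hTTP]
  refine ⟨H * R * P * R, posSemidef_iff_real.2 ⟨?_, fun z => ?_⟩, ?_⟩
  · rw [fromBlocks_transpose, hH.transpose_eq_self, hS.transpose_eq_self, transpose_transpose]
  · have hz : z = Sum.elim (z ∘ Sum.inl) (z ∘ Sum.inr) := by ext (i | i) <;> rfl
    rw [hz, quadForm_fromBlocks]
    set x := z ∘ Sum.inl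
    set y := z ∘ Sum.inr
    -- Completing the square leaves `‖r - E r‖²`, with `E` the projection onto the range of `T`.
    set r := R *ᵥ y with hr
    set u := R *ᵥ P *ᵥ r with hu
    have h1 := hH.quadForm_nonneg (x + u)
    have h2 : (H * R * P * R) *ᵥ y = H *ᵥ u := by
      simp only [hu, hr, mulVec_mulVec, Matrix.mul_assoc]
    have h3 : u ⬝ᵥ H *ᵥ u = (E *ᵥ r) ⬝ᵥ (E *ᵥ r) := by
      have : E *ᵥ r = T *ᵥ P *ᵥ r := (mulVec_mulVec _ _ _).symm
      rw [this, mulVec_dotProduct_of_symm hTp.transpose_eq_self, mulVec_mulVec _ T T, hTT, hu,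
        mulVec_dotProduct_of_symm hRh]
      simp only [mulVec_mulVec, Matrix.mul_assoc]
    have h4 : y ⬝ᵥ S *ᵥ y = r ⬝ᵥ r := by
      rw [hr, mulVec_dotProduct_of_symm hRh, mulVec_mulVec, hRR]
    have h5 : (E *ᵥ r) ⬝ᵥ (E *ᵥ r) = r ⬝ᵥ E *ᵥ r := by
      rw [mulVec_dotProduct_of_symm hEh, mulVec_mulVec, hEE]
    have h6 : 0 ≤ (r - E *ᵥ r) ⬝ᵥ (r - E *ᵥ r) := dotProduct_self_star_nonneg _
    have h7 : u ⬝ᵥ H *ᵥ x = x ⬝ᵥ H *ᵥ u := by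
      rw [← mulVec_dotProduct_of_symm hH.transpose_eq_self, dotProduct_comm]
    simp only [sub_dotProduct, dotProduct_sub, dotProduct_comm (E *ᵥ r) r] at h6
    simp only [mulVec_add, dotProduct_add, add_dotProduct, h7] at h1
    rw [h2, h4]
    linarith
  · calc (H * R * P * R).trace = (R * H * R * P).trace := by
          rw [trace_mul_comm]; simp only [Matrix.mul_assoc]
      _ = T.trace := by rw [← hTT, hTTP]

end Gelbrich

/-! ### The quadratic risk of a second moment matrix -/

section Risk

variable {n : Type*} [Fintype n]

/-- The risk `E[(βᵀ X - Y)²]` as a function of the second moment matrix `M` of `(X, Y)`: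
the quadratic form of `M` at `(β, -1)`. -/
def secondMomentRisk (M : Matrix (n ⊕ Unit) (n ⊕ Unit) ℝ) (β : n → ℝ) : ℝ :=
  Sum.elim β (fun _ : Unit => (-1 : ℝ)) ⬝ᵥ M *ᵥ Sum.elim β (fun _ : Unit => (-1 : ℝ))

theorem secondMomentRisk_bordered (A : Matrix n n ℝ) (b : n → ℝ) (c : ℝ) (β : n → ℝ) :
    secondMomentRisk (bordered A b c) β = β ⬝ᵥ A *ᵥ β - 2 * (b ⬝ᵥ β) + c := by
  rw [secondMomentRisk, quadForm_bordered]
  ring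

theorem le_secondMomentRisk {A : Matrix n n ℝ} {b : n → ℝ} {c τ : ℝ}
    (h : (bordered A b (c - τ)).PosSemidef) (β : n → ℝ) :
    τ ≤ secondMomentRisk (bordered A b c) β := by
  have := h.quadForm_nonneg (Sum.elim β fun _ => -1)
  rw [quadForm_bordered] at this
  rw [secondMomentRisk_bordered]
  linarith

/-- If `β` solves the normal equations, then its risk is a feasible value of `τ`: this is the
Schur complement of `A`. -/
theorem posSemidef_bordered_sub_risk {A : Matrix n n ℝ} (hA : A.PosSemidef) {b β : n → ℝ}
    (c : ℝ) (hβ : A *ᵥ β = b) :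
    (bordered A b (c - secondMomentRisk (bordered A b c) β)).PosSemidef := by
  refine posSemidef_bordered hA.transpose_eq_self fun x s => ?_
  have h := hA.quadForm_nonneg (x + s • β)
  have h1 : x ⬝ᵥ b = b ⬝ᵥ x := dotProduct_comm _ _
  have h2 : β ⬝ᵥ A *ᵥ x = b ⬝ᵥ x := by
    rw [← mulVec_dotProduct_of_symm hA.transpose_eq_self, hβ]
  have h3 : β ⬝ᵥ b = b ⬝ᵥ β := dotProduct_comm _ _
  simp only [mulVec_add, mulVec_smul, dotProduct_add, add_dotProduct, smul_dotProduct,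
    dotProduct_smul, smul_eq_mul, hβ, h1, h2, h3] at h
  rw [secondMomentRisk_bordered, hβ, h3]
  linarith

/-- Quantitative optimality of the solution `γ` of the normal equations of `A`: if `β` satisfies
them up to the residual `r`, then its excess risk is at most `‖r‖² / ε`, where `A ⪰ ε I`. -/
theorem secondMomentRisk_le_add_residual [DecidableEq n] {A : Matrix n n ℝ} {ε : ℝ}
    (hε : 0 < ε) (hA : (A - ε • (1 : Matrix n n ℝ)).PosSemidef) (hAs : Aᵀ = A)
    {b β γ r : n → ℝ} (c : ℝ) (hγ : A *ᵥ γ = b) (hβ : A *ᵥ β = b + r) :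
    secondMomentRisk (bordered A b c) β ≤ secondMomentRisk (bordered A b c) γ + r ⬝ᵥ r / ε := by
  set δ := β - γ with hδ
  have hβδ : β = γ + δ := by simp [hδ]
  have hAδ : A *ᵥ δ = r := by rw [hδ, mulVec_sub, hβ, hγ, add_sub_cancel_left]
  have h1 : ε * (δ ⬝ᵥ δ) ≤ δ ⬝ᵥ r := by
    have := hA.quadForm_nonneg δ
    rw [sub_mulVec, dotProduct_sub, hAδ, smul_mulVec, one_mulVec, dotProduct_smul,
      smul_eq_mul] at this
    linarith
  have h2 : 0 ≤ (r - ε • δ) ⬝ᵥ (r - ε • δ) := dotProduct_self_star_nonneg _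
  have h3 : r ⬝ᵥ δ = δ ⬝ᵥ r := dotProduct_comm _ _
  simp only [sub_dotProduct, dotProduct_sub, smul_dotProduct, dotProduct_smul, smul_eq_mul,
    h3] at h2
  have h4 : δ ⬝ᵥ r ≤ r ⬝ᵥ r / ε := by
    rw [le_div_iff₀ hε]
    nlinarith [mul_le_mul_of_nonneg_left h1 hε.le]
  have h5 : δ ⬝ᵥ b = b ⬝ᵥ δ := dotProduct_comm _ _
  have h6 : γ ⬝ᵥ r = b ⬝ᵥ δ := by
    rw [← hAδ, ← mulVec_dotProduct_of_symm hAs, hγ]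
  rw [secondMomentRisk_bordered, secondMomentRisk_bordered, hβ, hγ, hβδ]
  simp only [dotProduct_add, add_dotProduct, h5, h6]
  linarith

end Risk

/-! ### The feasible set of the semidefinite program -/

section Feasible

theorem norm_toLp_sq {n : Type*} [Fintype n] (x : n → ℝ) : ‖WithLp.toLp 2 x‖ ^ 2 = x ⬝ᵥ x := by
  rw [EuclideanSpace.real_norm_sq_eq]
  simp [dotProduct, sq]

theorem trace_vecMulVec_self {n : Type*} [Fintype n] (x : n → ℝ) :
    (vecMulVec x x).trace = x ⬝ᵥ x := by
  simp [trace, vecMulVec_apply, dotProduct]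

theorem wassersteinDiv_eq {n : Type*} [Fintype n] [DecidableEq n] (μ m : n → ℝ)
    (Sig S : Matrix n n ℝ) :
    wassersteinDiv μ Sig m S = ‖WithLp.toLp 2 m‖ ^ 2 - 2 * (m ⬝ᵥ μ)
      + ((Sig + vecMulVec μ μ).trace + S.trace)
      - 2 * (CFC.sqrt (CFC.sqrt S * Sig * CFC.sqrt S)).trace := by
  rw [wassersteinDiv, norm_toLp_sq, norm_toLp_sq]
  simp only [trace_sub, trace_add, trace_smul, trace_vecMulVec_self, sub_dotProduct,
    dotProduct_sub, dotProduct_comm μ m, smul_eq_mul]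
  ring

theorem bordered_convexComb {n : Type*} (A A' : Matrix n n ℝ) (b b' : n → ℝ) (c c' s t : ℝ) :
    bordered (s • A + t • A') (s • b + t • b') (s * c + t * c')
      = s • bordered A b c + t • bordered A' b' c' := by
  ext (i | i) (j | j) <;> simp [bordered]

variable {d : ℕ} {μhat : Domain → Joint d → ℝ}
  {Sighat : Domain → Matrix (Joint d) (Joint d) ℝ} {ρ : Domain → ℝ} {ε : ℝ}

/-- The combination `s v + t w` of two points of the semidefinite program. -/
def SDPVar.comb (s t : ℝ) (v w : SDPVar d) : SDPVar d where
  MXX := s • v.MXX + t • w.MXX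
  MXY := s • v.MXY + t • w.MXY
  MYY := s * v.MYY + t * w.MYY
  τ := s * v.τ + t * w.τ
  μ := s • v.μ + t • w.μ
  M := s • v.M + t • w.M
  H := s • v.H + t • w.H
  C k := s • v.C k + t • w.C k

theorem SDPFeasible.comb {v w : SDPVar d} (hv : SDPFeasible μhat Sighat ρ ε v)
    (hw : SDPFeasible μhat Sighat ρ ε w) {s t : ℝ} (hs : 0 ≤ s) (ht : 0 ≤ t) (hst : s + t = 1) :
    SDPFeasible μhat Sighat ρ ε (v.comb s t w) where
  τ_nonneg := add_nonneg (mul_nonneg hs hv.τ_nonneg) (mul_nonneg ht hw.τ_nonneg)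
  M_psd := hv.M_psd.convexComb hw.M_psd hs ht
  H_psd := hv.H_psd.convexComb hw.H_psd hs ht
  ball k := by
    have h := add_le_add (mul_le_mul_of_nonneg_left (hv.ball k) hs)
      (mul_le_mul_of_nonneg_left (hw.ball k) ht)
    refine le_trans (le_of_eq ?_) (h.trans_eq (by rw [← add_mul, hst, one_mul]))
    simp only [SDPVar.comb, trace_add, trace_sub, trace_smul, dotProduct_add, dotProduct_smul,
      smul_eq_mul]
    linear_combination
      (-(‖WithLp.toLp 2 (μhat k)‖ ^ 2 + (Sighat k).trace)) * hst
  C_block k := by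
    convert (hv.C_block k).convexComb (hw.C_block k) hs ht using 1
    simp only [SDPVar.comb, fromBlocks_smul, fromBlocks_add, transpose_add, transpose_smul,
      ← add_smul, hst, one_smul]
  H_block := by
    convert hv.H_block.convexComb hw.H_block hs ht using 1
    rw [← bordered_convexComb]
    simp only [SDPVar.comb, mul_one, hst]
    congr 1
    simp only [smul_sub]
    abel
  τ_block := by
    convert hv.τ_block.convexComb hw.τ_block hs ht using 1
    rw [← bordered_convexComb]
    simp only [SDPVar.comb]
    congr 1
    ring
  M_eq := by
    simp only [SDPVar.comb]
    rw [bordered_convexComb, ← hv.M_eq, ← hw.M_eq]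
  M_ge := by
    convert hv.M_ge.convexComb hw.M_ge hs ht using 1
    simp only [SDPVar.comb, smul_sub, smul_smul]
    rw [show ε = s * ε + t * ε by rw [← add_mul, hst, one_mul], add_smul]
    simp only [← add_mul, hst, one_mul]
    abel

theorem SDPFeasible.setTau {v : SDPVar d} (hv : SDPFeasible μhat Sighat ρ ε v) {τ' : ℝ}
    (h0 : 0 ≤ τ') (h : (bordered v.MXX v.MXY (v.MYY - τ')).PosSemidef) :
    SDPFeasible μhat Sighat ρ ε { v with τ := τ' } :=
  { hv with τ_nonneg := h0, τ_block := h }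

theorem SDPFeasible.MXX_ge {v : SDPVar d} (hv : SDPFeasible μhat Sighat ρ ε v) :
    (v.MXX - ε • (1 : Matrix (Fin d) (Fin d) ℝ)).PosSemidef := by
  convert hv.M_ge.submatrix Sum.inl using 1
  rw [hv.M_eq]
  ext i j
  simp [bordered, one_apply]

theorem SDPFeasible.sub_mean_posSemidef {v : SDPVar d} (hv : SDPFeasible μhat Sighat ρ ε v) :
    (v.M - v.H - vecMulVec v.μ v.μ).PosSemidef :=
  posSemidef_bordered_one_iff.1 hv.H_block

/-- Every feasible point gives a pair in the moment set. The covariance matrix `M - μ μᵀ`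
dominates `H`, so that it can replace `H` in the block constraints. -/
theorem SDPFeasible.mem_momentSet (hS : ∀ k, (Sighat k).PosSemidef) {v : SDPVar d}
    (hv : SDPFeasible μhat Sighat ρ ε v) :
    (v.μ, v.M - vecMulVec v.μ v.μ) ∈ momentSet μhat Sighat ρ ε := by
  have hdiff := hv.sub_mean_posSemidef
  have hSig : (v.M - vecMulVec v.μ v.μ).PosSemidef := by
    convert hdiff.add hv.H_psd using 1
    abel
  refine ⟨hSig, fun k => ?_, ?_⟩
  · have hblock :
        (fromBlocks (v.M - vecMulVec v.μ v.μ) (v.C k) (v.C k)ᵀ (Sighat k)).PosSemidef := by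
      refine posSemidef_iff_real.2 ⟨?_, fun z => ?_⟩
      · rw [fromBlocks_transpose, hSig.transpose_eq_self, (hS k).transpose_eq_self,
          transpose_transpose]
      · have hz : z = Sum.elim (z ∘ Sum.inl) (z ∘ Sum.inr) := by ext (i | i) <;> rfl
        have h1 := (hv.C_block k).quadForm_nonneg z
        have h2 := hdiff.quadForm_nonneg (z ∘ Sum.inl)
        rw [hz, quadForm_fromBlocks] at h1 ⊢
        simp only [sub_mulVec, dotProduct_sub] at h2 ⊢
        linarith
    have htr := trace_le_trace_sqrt hSig (hS k) hblock
    have hb := hv.ball k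
    rw [wassersteinDiv_eq, sub_add_cancel]
    simp only [trace_sub, trace_add, trace_smul, smul_eq_mul] at hb
    linarith
  · simpa using hv.M_ge

/-- Every pair of the moment set comes from a feasible point, with `H` its covariance matrix
and `C k` the maximisers of `exists_trace_eq_trace_sqrt`. -/
theorem exists_feasible_of_mem_momentSet (hS : ∀ k, (Sighat k).PosSemidef)
    {u : (Joint d → ℝ) × Matrix (Joint d) (Joint d) ℝ}
    (hu : u ∈ momentSet μhat Sighat ρ ε) :
    ∃ v, SDPFeasible μhat Sighat ρ ε v ∧ v.M = u.2 + vecMulVec u.1 u.1 := by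
  obtain ⟨hSig, hball, hge⟩ := hu
  choose C hC hCtr using fun k => exists_trace_eq_trace_sqrt hSig (hS k)
  set M := u.2 + vecMulVec u.1 u.1 with hM
  have hMp : M.PosSemidef := hSig.add (posSemidef_vecMulVec _)
  have hMeq : M = bordered M.toBlocks₁₁ (fun i => M (Sum.inl i) (Sum.inr ()))
      (M (Sum.inr ()) (Sum.inr ())) := by
    ext (i | i) (j | j)
    · rfl
    · rfl
    · exact congrFun (congrFun hMp.transpose_eq_self (Sum.inl j)) (Sum.inr ())
    · rfl
  refine ⟨⟨M.toBlocks₁₁, fun i => M (Sum.inl i) (Sum.inr ()), M (Sum.inr ()) (Sum.inr ()), 0,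
    u.1, M, u.2, C⟩, ⟨le_rfl, hMp, hSig, fun k => ?_, hC, ?_, ?_, hMeq, hge⟩, rfl⟩
  · have h := hball k
    rw [wassersteinDiv_eq] at h
    simp only [trace_sub, trace_add, trace_smul, smul_eq_mul, hCtr, hM] at h ⊢
    linarith
  · rw [posSemidef_bordered_one_iff]
    simpa [hM] using PosSemidef.zero
  · dsimp only
    rw [sub_zero, ← hMeq]
    exact hMp

end Feasible

/-! ### The saddle point property -/

section Saddle

variable {d : ℕ} {μhat : Domain → Joint d → ℝ}
  {Sighat : Domain → Matrix (Joint d) (Joint d) ℝ} {ρ : Domain → ℝ} {ε : ℝ}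

theorem SDPFeasible.isUnit_det {v : SDPVar d} (hε : 0 < ε)
    (hv : SDPFeasible μhat Sighat ρ ε v) : IsUnit v.MXX.det :=
  (isUnit_iff_isUnit_det _).1 (posDef_of_sub_smul_one hε hv.MXX_ge).isUnit

theorem SDPFeasible.normalEq {v : SDPVar d} (hε : 0 < ε)
    (hv : SDPFeasible μhat Sighat ρ ε v) : v.MXX *ᵥ v.MXX⁻¹ *ᵥ v.MXY = v.MXY := by
  rw [mulVec_mulVec, mul_nonsing_inv _ (hv.isUnit_det hε), one_mulVec]

/-- The optimal value dominates the least risk at every feasible second moment matrix. -/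
theorem SDPOptimal.risk_le_of_normalEq {v w : SDPVar d} (hε : 0 < ε)
    (hv : SDPOptimal μhat Sighat ρ ε v) (hw : SDPFeasible μhat Sighat ρ ε w) {β : Fin d → ℝ}
    (hβ : w.MXX *ᵥ β = w.MXY) : secondMomentRisk w.M β ≤ v.τ := by
  have hMXX := (posDef_of_sub_smul_one hε hw.MXX_ge).posSemidef
  refine hv.2 _ (hw.setTau (hw.M_psd.quadForm_nonneg _) ?_)
  have := posSemidef_bordered_sub_risk hMXX w.MYY hβ
  rwa [← hw.M_eq] at this

/-- At an optimal solution, no feasible second moment matrix has a larger risk at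
`β⋆ = M_XX⁻¹ M_XY` than the optimal value. This is an envelope argument: moving from `v` to `w`
by a fraction `t` changes the risk of `β⋆` to first order in `t`, but its distance from the
least risk only to second order. -/
theorem SDPOptimal.risk_le {v w : SDPVar d} (hε : 0 < ε)
    (hv : SDPOptimal μhat Sighat ρ ε v) (hw : SDPFeasible μhat Sighat ρ ε w) :
    secondMomentRisk w.M (v.MXX⁻¹ *ᵥ v.MXY) ≤ v.τ := by
  set β := v.MXX⁻¹ *ᵥ v.MXY with hβ
  have hvβ : v.MXX *ᵥ β = v.MXY := hv.1.normalEq hε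
  set g := w.MXX *ᵥ β - w.MXY with hg
  have hvτ : v.τ ≤ secondMomentRisk v.M β := by
    rw [hv.1.M_eq]
    exact le_secondMomentRisk hv.1.τ_block β
  have key : ∀ t : ℝ, 0 < t → t ≤ 1 → secondMomentRisk w.M β ≤ v.τ + t * (g ⬝ᵥ g / ε) := by
    intro t ht ht1
    have hx := hv.1.comb hw (sub_nonneg.2 ht1) ht.le (sub_add_cancel 1 t)
    set x := v.comb (1 - t) t w with hxdef
    have hxβ : x.MXX *ᵥ β = x.MXY + t • g := by
      simp only [hxdef, SDPVar.comb, add_mulVec, smul_mulVec, hvβ, hg, smul_sub]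
      abel
    have h1 := secondMomentRisk_le_add_residual hε hx.MXX_ge
      (posDef_of_sub_smul_one hε hx.MXX_ge).posSemidef.transpose_eq_self x.MYY
      (hx.normalEq hε) hxβ
    rw [← hx.M_eq] at h1
    have h2 := hv.risk_le_of_normalEq hε hx (hx.normalEq hε)
    have h3 : secondMomentRisk x.M β
        = (1 - t) * secondMomentRisk v.M β + t * secondMomentRisk w.M β := by
      simp only [secondMomentRisk, hxdef, SDPVar.comb, add_mulVec, smul_mulVec, dotProduct_add,
        dotProduct_smul, smul_eq_mul]
    have h4 : (t • g) ⬝ᵥ (t • g) / ε = t * (t * (g ⬝ᵥ g / ε)) := by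
      simp only [smul_dotProduct, dotProduct_smul, smul_eq_mul]
      ring
    have h5 := mul_le_mul_of_nonneg_left hvτ (sub_nonneg.2 ht1)
    rw [h3, h4] at h1
    refine le_of_mul_le_mul_left ?_ ht
    linarith
  have hgg : 0 ≤ g ⬝ᵥ g / ε := div_nonneg (dotProduct_self_star_nonneg g) hε.le
  refine le_of_forall_pos_le_add fun e he => ?_
  have hk : 0 < g ⬝ᵥ g / ε + 1 := by positivity
  have ht : 0 < min 1 (e / (g ⬝ᵥ g / ε + 1)) := lt_min one_pos (div_pos he hk)
  refine (key _ ht (min_le_left _ _)).trans (add_le_add le_rfl ?_)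
  calc _ ≤ e / (g ⬝ᵥ g / ε + 1) * (g ⬝ᵥ g / ε) :=
        mul_le_mul_of_nonneg_right (min_le_right _ _) hgg
    _ ≤ e := by
        rw [div_mul_eq_mul_div, div_le_iff₀ hk]
        nlinarith

end Saddle

/-! ### Existence of an optimal solution -/

section Existence

theorem _root_.Matrix.PosSemidef.abs_apply_le_trace {n : Type*} [Fintype n] [DecidableEq n]
    {A : Matrix n n ℝ} (hA : A.PosSemidef) (i j : n) : |A i j| ≤ A.trace := by
  have hdiag : ∀ i, A i i ≤ A.trace := fun i =>
    Finset.single_le_sum (f := fun i => A i i) (fun k _ => hA.diag_nonneg) (Finset.mem_univ i)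
  have hsym : A j i = A i j := congrFun (congrFun hA.transpose_eq_self i) j
  have hq : ∀ s : ℝ, 0 ≤ A i i + 2 * s * A i j + s ^ 2 * A j j := fun s => by
    have := hA.quadForm_nonneg (Pi.single i 1 + s • Pi.single j 1)
    simp [mulVec_add, mulVec_smul, add_dotProduct, dotProduct_add, hsym] at this
    linarith
  have h1 := hq 1
  have h2 := hq (-1)
  rw [abs_le]
  constructor <;> linarith [hdiag i, hdiag j]

variable {d : ℕ} {μhat : Domain → Joint d → ℝ}
  {Sighat : Domain → Matrix (Joint d) (Joint d) ℝ} {ρ : Domain → ℝ} {ε : ℝ}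

theorem SDPFeasible.trace_H_le {v : SDPVar d} (hv : SDPFeasible μhat Sighat ρ ε v) :
    v.H.trace + v.μ ⬝ᵥ v.μ ≤ v.M.trace := by
  have := hv.sub_mean_posSemidef.trace_nonneg
  rw [trace_sub, trace_sub, trace_vecMulVec_self] at this
  linarith

/-- A single ball constraint bounds the trace of the second moment matrix, because both
`μhatᵀ μ` and `Tr C` grow at most like the square root of that trace. -/
theorem SDPFeasible.trace_M_le {v : SDPVar d} (hv : SDPFeasible μhat Sighat ρ ε v) (k : Domain) :
    v.M.trace ≤ 2 * (ρ k + 3 * (μhat k ⬝ᵥ μhat k) + (Sighat k).trace) := by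
  have hb := hv.ball k
  rw [norm_toLp_sq] at hb
  simp only [trace_sub, trace_add, trace_smul, smul_eq_mul] at hb
  have hH := hv.trace_H_le
  have hC : 2 * (v.C k).trace ≤ 1 / 2 * v.H.trace + 2 * (Sighat k).trace := by
    have hA : ((1 / 2 : ℝ) • (1 : Matrix (Joint d) (Joint d) ℝ)).PosDef :=
      PosDef.one.smul (by norm_num)
    have hinv : ((1 / 2 : ℝ) • (1 : Matrix (Joint d) (Joint d) ℝ))⁻¹ = (2 : ℝ) • 1 :=
      inv_eq_left_inv (by simp [smul_smul])
    have := two_mul_trace_le_of_posDef (hv.C_block k) hA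
    rw [hinv] at this
    simpa using this
  -- The factor `4` keeps a quarter of `‖μ‖²` on the right, which `hH` absorbs.
  have hm : 0 ≤ (v.μ - (4 : ℝ) • μhat k) ⬝ᵥ (v.μ - (4 : ℝ) • μhat k) :=
    dotProduct_self_star_nonneg _
  have hμ : 0 ≤ v.μ ⬝ᵥ v.μ := dotProduct_self_star_nonneg _
  simp only [sub_dotProduct, dotProduct_sub, smul_dotProduct, dotProduct_smul, smul_eq_mul,
    dotProduct_comm v.μ (μhat k)] at hm
  linarith

/-- The independent variables `(M, τ, μ, H, C)` of the semidefinite program. -/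
abbrev SDPData (d : ℕ) :=
  Matrix (Joint d) (Joint d) ℝ × ℝ × (Joint d → ℝ) × Matrix (Joint d) (Joint d) ℝ ×
    (Domain → Matrix (Joint d) (Joint d) ℝ)

/-- The point of the semidefinite program with the blocks of `M` filled in. -/
def SDPData.toVar (x : SDPData d) : SDPVar d where
  MXX := x.1.toBlocks₁₁
  MXY i := x.1 (Sum.inl i) (Sum.inr ())
  MYY := x.1 (Sum.inr ()) (Sum.inr ())
  τ := x.2.1
  μ := x.2.2.1
  M := x.1
  H := x.2.2.2.1
  C := x.2.2.2.2

theorem SDPFeasible.toVar_eq {v : SDPVar d} (hv : SDPFeasible μhat Sighat ρ ε v) :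
    SDPData.toVar (v.M, v.τ, v.μ, v.H, v.C) = v := by
  obtain ⟨MXX, MXY, MYY, τ, μ, M, H, C⟩ := v
  obtain rfl : M = bordered MXX MXY MYY := hv.M_eq
  simp [SDPData.toVar, bordered]

@[fun_prop]
theorem continuous_bordered {X n : Type*} [TopologicalSpace X] {A : X → Matrix n n ℝ}
    {b : X → n → ℝ} {c : X → ℝ} (hA : Continuous A) (hb : Continuous b) (hc : Continuous c) :
    Continuous fun x => bordered (A x) (b x) (c x) := by
  refine Continuous.matrix_fromBlocks hA ?_ ?_ ?_ <;>
  exact continuous_matrix fun i j => by simp; fun_prop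

theorem isClosed_feasible :
    IsClosed {x : SDPData d | SDPFeasible μhat Sighat ρ ε x.toVar} := by
  have hset : {x : SDPData d | SDPFeasible μhat Sighat ρ ε x.toVar} =
      {x | 0 ≤ x.toVar.τ} ∩ {x | x.toVar.M.PosSemidef} ∩ {x | x.toVar.H.PosSemidef} ∩
      {x | ∀ k, ‖WithLp.toLp 2 (μhat k)‖ ^ 2 - 2 * (μhat k ⬝ᵥ x.toVar.μ)
        + (x.toVar.M + Sighat k - (2 : ℝ) • x.toVar.C k).trace ≤ ρ k} ∩
      {x | ∀ k, (fromBlocks x.toVar.H (x.toVar.C k) (x.toVar.C k)ᵀ (Sighat k)).PosSemidef} ∩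
      {x | (bordered (x.toVar.M - x.toVar.H) x.toVar.μ 1).PosSemidef} ∩
      {x | (bordered x.toVar.MXX x.toVar.MXY (x.toVar.MYY - x.toVar.τ)).PosSemidef} ∩
      {x | x.toVar.M = bordered x.toVar.MXX x.toVar.MXY x.toVar.MYY} ∩
      {x | (x.toVar.M - ε • (1 : Matrix (Joint d) (Joint d) ℝ)).PosSemidef} := by
    ext x
    exact ⟨fun ⟨h1, h2, h3, h4, h5, h6, h7, h8, h9⟩ =>
      ⟨⟨⟨⟨⟨⟨⟨⟨h1, h2⟩, h3⟩, h4⟩, h5⟩, h6⟩, h7⟩, h8⟩, h9⟩,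
      fun ⟨⟨⟨⟨⟨⟨⟨⟨h1, h2⟩, h3⟩, h4⟩, h5⟩, h6⟩, h7⟩, h8⟩, h9⟩ =>
      ⟨h1, h2, h3, h4, h5, h6, h7, h8, h9⟩⟩
  have hMXX : Continuous fun x : SDPData d => x.toVar.MXX :=
    continuous_matrix fun i j => continuous_fst.matrix_elem _ _
  have hMXY : Continuous fun x : SDPData d => x.toVar.MXY :=
    continuous_pi fun i => continuous_fst.matrix_elem _ _
  have hMYY : Continuous fun x : SDPData d => x.toVar.MYY := continuous_fst.matrix_elem _ _
  have hτ : Continuous fun x : SDPData d => x.toVar.τ := by unfold SDPData.toVar; fun_prop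
  have hμ : Continuous fun x : SDPData d => x.toVar.μ := by unfold SDPData.toVar; fun_prop
  have hM : Continuous fun x : SDPData d => x.toVar.M := by unfold SDPData.toVar; fun_prop
  have hH : Continuous fun x : SDPData d => x.toVar.H := by unfold SDPData.toVar; fun_prop
  have hC : ∀ k, Continuous fun x : SDPData d => x.toVar.C k := fun k => by
    unfold SDPData.toVar; fun_prop
  rw [hset]
  refine ((((((((isClosed_le continuous_const hτ).inter ?_).inter ?_).inter ?_).inter ?_).inter
    ?_).inter ?_).inter (isClosed_eq hM (by fun_prop))).inter ?_
  · exact isClosed_posSemidef.preimage hM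
  · exact isClosed_posSemidef.preimage hH
  · simp only [Set.ofPred_forall]
    exact isClosed_iInter fun k => isClosed_le (by fun_prop) continuous_const
  · simp only [Set.ofPred_forall]
    exact isClosed_iInter fun k => isClosed_posSemidef.preimage
      (hH.matrix_fromBlocks (hC k) (hC k).matrix_transpose continuous_const)
  · exact isClosed_posSemidef.preimage (by fun_prop)
  · exact isClosed_posSemidef.preimage (by fun_prop)
  · exact isClosed_posSemidef.preimage (by fun_prop)

/-- The matrices with all entries in `[-K, K]`. -/
def matrixBox (m n : Type*) (K : ℝ) : Set (Matrix m n ℝ) :=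
  Set.univ.pi fun _ => Set.univ.pi fun _ => Set.Icc (-K) K

theorem isCompact_matrixBox (m n : Type*) (K : ℝ) : IsCompact (matrixBox m n K) :=
  isCompact_univ_pi fun _ => isCompact_univ_pi fun _ => isCompact_Icc

theorem mem_matrixBox {m n : Type*} {K : ℝ} {A : Matrix m n ℝ} (h : ∀ i j, |A i j| ≤ K) :
    A ∈ matrixBox m n K :=
  fun i _ j _ => abs_le.1 (h i j)

/-- Each matrix variable is a block of a positive semidefinite matrix of bounded trace, and
the entries of such a matrix are bounded by its trace. -/
theorem isCompact_feasible :
    IsCompact {x : SDPData d | SDPFeasible μhat Sighat ρ ε x.toVar} := by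
  let K := 2 * (ρ .S + 3 * (μhat .S ⬝ᵥ μhat .S) + (Sighat .S).trace)
  refine ((isCompact_matrixBox _ _ K).prod <| (isCompact_Icc (a := -K) (b := K)).prod <|
    (isCompact_univ_pi fun _ => isCompact_Icc (a := -(K + 1)) (b := K + 1)).prod <|
    (isCompact_matrixBox _ _ K).prod <| isCompact_univ_pi fun k =>
      isCompact_matrixBox _ _ (K + (Sighat k).trace)).of_isClosed_subset isClosed_feasible ?_
  rintro x hx
  have hMK : x.1.trace ≤ K := hx.trace_M_le .S
  have hHM : x.2.2.2.1.trace + x.2.2.1 ⬝ᵥ x.2.2.1 ≤ x.1.trace := hx.trace_H_le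
  have hμ : 0 ≤ x.2.2.1 ⬝ᵥ x.2.2.1 := dotProduct_self_star_nonneg _
  have hH : 0 ≤ x.2.2.2.1.trace := hx.H_psd.trace_nonneg
  refine ⟨mem_matrixBox fun i j => (hx.M_psd.abs_apply_le_trace i j).trans hMK, ?_, ?_,
    mem_matrixBox fun i j => (hx.H_psd.abs_apply_le_trace i j).trans ?_, ?_⟩
  · have h0 : 0 ≤ x.2.1 := hx.τ_nonneg
    have h1 : 0 ≤ x.1 (Sum.inr ()) (Sum.inr ()) - x.2.1 :=
      hx.τ_block.diag_nonneg (i := Sum.inr ())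
    have h2 := (abs_le.1 (hx.M_psd.abs_apply_le_trace (Sum.inr ()) (Sum.inr ()))).2
    change x.1 _ _ ≤ x.1.trace at h2
    exact ⟨by linarith, by linarith⟩
  · intro i _
    have h := hx.H_block.abs_apply_le_trace (Sum.inl i) (Sum.inr ())
    have htr : (bordered (x.1 - x.2.2.2.1) x.2.2.1 1).trace
        = x.1.trace - x.2.2.2.1.trace + 1 := by
      rw [← trace_sub]
      simp [bordered, trace]
    change |x.2.2.1 i| ≤ (bordered (x.1 - x.2.2.2.1) x.2.2.1 1).trace at h
    rw [htr] at h
    exact abs_le.1 (h.trans (by linarith))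
  · change x.2.2.2.1.trace ≤ K
    linarith
  · intro k _
    refine mem_matrixBox fun i j => ?_
    have h := (hx.C_block k).abs_apply_le_trace (Sum.inl i) (Sum.inr j)
    have htr : (fromBlocks x.2.2.2.1 (x.2.2.2.2 k) (x.2.2.2.2 k)ᵀ (Sighat k)).trace
        = x.2.2.2.1.trace + (Sighat k).trace := by
      simp [trace]
    change |x.2.2.2.2 k i j| ≤
      (fromBlocks x.2.2.2.1 (x.2.2.2.2 k) (x.2.2.2.2 k)ᵀ (Sighat k)).trace at h
    rw [htr] at h
    linarith

theorem exists_sdpOptimal {v₀ : SDPVar d}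
    (hv₀ : SDPFeasible μhat Sighat ρ ε v₀) : ∃ v, SDPOptimal μhat Sighat ρ ε v := by
  have hcont : Continuous fun x : SDPData d => x.2.1 := by fun_prop
  obtain ⟨x, hx, hmax⟩ := (isCompact_feasible (μhat := μhat) (ρ := ρ) (ε := ε)).exists_isMaxOn
    ⟨(v₀.M, v₀.τ, v₀.μ, v₀.H, v₀.C), by rwa [Set.mem_ofPred_eq, hv₀.toVar_eq]⟩ hcont.continuousOn
  refine ⟨x.toVar, hx, fun w hw => ?_⟩
  exact hmax (a := (w.M, w.τ, w.μ, w.H, w.C)) (by rwa [Set.mem_ofPred_eq, hw.toVar_eq])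

end Existence

/-! ### Distributions with given moments -/

section Moments

variable {n : Type*} [Fintype n]

omit [Fintype n] in
theorem HasMoments.integral_mul {Q : Measure (n → ℝ)} {μ : n → ℝ} {Sig : Matrix n n ℝ}
    (h : HasMoments Q μ Sig) (i j : n) :
    ∫ ξ, ξ i * ξ j ∂Q = (Sig + vecMulVec μ μ) i j := by
  have := h.prob
  have hc := covariance_eq_sub (h.memLp i) (h.memLp j)
  rw [h.cov, h.mean, h.mean] at hc
  simp only [Pi.mul_apply] at hc
  rw [Matrix.add_apply, vecMulVec_apply]
  linarith

theorem HasMoments.lintegral_sq {Q : Measure (n → ℝ)} {μ : n → ℝ} {Sig : Matrix n n ℝ}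
    (h : HasMoments Q μ Sig) (z : n → ℝ) :
    ∫⁻ ξ, ENNReal.ofReal ((z ⬝ᵥ ξ) ^ 2) ∂Q
      = ENNReal.ofReal (z ⬝ᵥ (Sig + vecMulVec μ μ) *ᵥ z) := by
  have hexp : ∀ ξ : n → ℝ, (z ⬝ᵥ ξ) ^ 2 = ∑ i, ∑ j, z i * z j * (ξ i * ξ j) := fun ξ => by
    rw [sq, dotProduct, Finset.sum_mul_sum]
    exact Finset.sum_congr rfl fun i _ => Finset.sum_congr rfl fun j _ => by ring
  have hint : ∀ i j, Integrable (fun ξ : n → ℝ => z i * z j * (ξ i * ξ j)) Q := fun i j =>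
    ((h.memLp i).integrable_mul (h.memLp j)).const_mul _
  rw [← ofReal_integral_eq_lintegral_ofReal _ (ae_of_all _ fun ξ => sq_nonneg _)]
  · congr 1
    simp only [hexp]
    rw [integral_finsetSum _ fun i _ => integrable_finsetSum _ fun j _ => hint i j]
    simp only [dotProduct, mulVec, Finset.mul_sum]
    refine Finset.sum_congr rfl fun i _ => ?_
    rw [integral_finsetSum _ fun j _ => hint i j]
    refine Finset.sum_congr rfl fun j _ => ?_
    rw [integral_const_mul, h.integral_mul]
    ring
  · simp only [hexp]
    exact integrable_finsetSum _ fun i _ => integrable_finsetSum _ fun j _ => hint i j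

/-- The Gaussian distribution realises any mean vector and covariance matrix. -/
theorem exists_hasMoments [DecidableEq n] (μ : n → ℝ) {Sig : Matrix n n ℝ}
    (hSig : Sig.PosSemidef) : ∃ Q : Measure (n → ℝ), HasMoments Q μ Sig := by
  set G := multivariateGaussian (WithLp.toLp 2 μ) Sig
  have hm : Measurable (WithLp.ofLp : EuclideanSpace ℝ n → n → ℝ) := by fun_prop
  have hL : ∀ i, MemLp (fun x : EuclideanSpace ℝ n => x i) 2 G := fun i =>
    (EuclideanSpace.proj i : EuclideanSpace ℝ n →L[ℝ] ℝ).comp_memLp' IsGaussian.memLp_two_id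
  have hξ : ∀ i, AEStronglyMeasurable (fun ξ : n → ℝ => ξ i) (G.map WithLp.ofLp) := fun i =>
    (measurable_pi_apply i).aestronglyMeasurable
  refine ⟨G.map WithLp.ofLp, Measure.isProbabilityMeasure_map hm.aemeasurable, fun i => ?_,
    fun i => ?_, fun i j => ?_⟩
  · rw [memLp_map_measure_iff (hξ i) hm.aemeasurable]
    exact hL i
  · rw [integral_map hm.aemeasurable (hξ i)]
    have h := ContinuousLinearMap.integral_comp_comm
      (EuclideanSpace.proj i : EuclideanSpace ℝ n →L[ℝ] ℝ)
      (IsGaussian.integrable_fun_id (μ := G))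
    rw [integral_id_multivariateGaussian] at h
    exact h
  · rw [covariance_map_fun (hξ i) (hξ j) hm.aemeasurable]
    exact covariance_eval_multivariateGaussian hSig i j

theorem HasMoments.lintegral_risk {d : ℕ} {Q : Measure (Joint d → ℝ)} {μ : Joint d → ℝ}
    {Sig : Matrix (Joint d) (Joint d) ℝ} (h : HasMoments Q μ Sig) (β : Fin d → ℝ) :
    ∫⁻ ξ, ENNReal.ofReal ((β ⬝ᵥ (fun i => ξ (Sum.inl i)) - ξ (Sum.inr ())) ^ 2) ∂Q
      = ENNReal.ofReal (secondMomentRisk (Sig + vecMulVec μ μ) β) := by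
  rw [secondMomentRisk, ← h.lintegral_sq]
  simp [dotProduct, sub_eq_add_neg]

end Moments

/-! ### The robust least-squares problem -/

/-- The regression vector of an optimal solution of the semidefinite program is one half of a
saddle point; the other half is any distribution with the optimal moments. -/
theorem SDPOptimal.solvesRobustLS {d : ℕ} {μhat : Domain → Joint d → ℝ}
    {Sighat : Domain → Matrix (Joint d) (Joint d) ℝ} {ρ : Domain → ℝ} {ε : ℝ}
    (hS : ∀ k, (Sighat k).PosSemidef) (hε : 0 < ε) {v : SDPVar d}
    (hv : SDPOptimal μhat Sighat ρ ε v) :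
    SolvesRobustLS (distributionSet μhat Sighat ρ ε) (v.MXX⁻¹ *ᵥ v.MXY) := by
  intro β
  calc worstCaseRisk (distributionSet μhat Sighat ρ ε) (v.MXX⁻¹ *ᵥ v.MXY)
      ≤ ENNReal.ofReal v.τ := by
        refine iSup₂_le ?_
        rintro Q ⟨u, hu, hQ⟩
        obtain ⟨w, hw, hwM⟩ := exists_feasible_of_mem_momentSet hS hu
        rw [hQ.lintegral_risk, ← hwM]
        exact ENNReal.ofReal_le_ofReal (hv.risk_le hε hw)
    _ ≤ worstCaseRisk (distributionSet μhat Sighat ρ ε) β := by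
        have hmem := hv.1.mem_momentSet hS
        obtain ⟨Q, hQ⟩ := exists_hasMoments v.μ hmem.1
        refine le_trans ?_ (le_iSup₂_of_le Q ⟨_, hmem, hQ⟩ le_rfl)
        rw [hQ.lintegral_risk, sub_add_cancel, hv.1.M_eq]
        exact ENNReal.ofReal_le_ofReal (le_secondMomentRisk hv.1.τ_block β)

end RobustLS

theorem mainTheorem2 (d : ℕ)
    (μhat : RobustLS.Domain → RobustLS.Joint d → ℝ)
    (Sighat : RobustLS.Domain → Matrix (RobustLS.Joint d) (RobustLS.Joint d) ℝ)
    (hSighat : ∀ k, (Sighat k).PosSemidef)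
    (ρ : RobustLS.Domain → ℝ) (ε : ℝ) (hε : 0 < ε)
    (hne : (RobustLS.distributionSet μhat Sighat ρ ε).Nonempty) :
    (∃ v, RobustLS.SDPOptimal μhat Sighat ρ ε v) ∧
    ∀ v, RobustLS.SDPOptimal μhat Sighat ρ ε v →
      IsUnit v.MXX.det ∧
      RobustLS.SolvesRobustLS (RobustLS.distributionSet μhat Sighat ρ ε)
        (v.MXX⁻¹ *ᵥ v.MXY) := by
  obtain ⟨Q, u, hu, -⟩ := hne
  obtain ⟨v₀, hv₀, -⟩ := RobustLS.exists_feasible_of_mem_momentSet hSighat hu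
  exact ⟨RobustLS.exists_sdpOptimal hv₀,
    fun v hv => ⟨hv.1.isUnit_det hε, hv.solvesRobustLS hSighat hε⟩⟩
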